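/- **Notation.** Let $S_n$ be the symmetric group on $[n]=\{1,\dots,n\}$, with simple transpositions $s_i=(i,i+1)$ for $1\le i\le n-1$, transpositions $t_{ij}=(i,j)$ (with $t_{ii}=e$), product given by composition of functions (so $wt_{ij}$ is $w$ with the values in positions $i,j$ exchanged), and length $\ell(w)$, the least number of factors in an expression of $w$ as a product of simple transpositions. A reduced word of $w$ is a word $(a_1,\dots,a_p)$ with $w=s_{a_1}\cdots s_{a_p}$ and $p=\ell(w)$. Write $v\lessdot w$ if $w=vt_{ij}$ for some $i\neq j$ and $\ell(w)=\ell(v)+1$. Let $\circ$ be the 0-Hecke product: $w\circ s_i=ws_i$ if $w\lessdot ws_i$ and $w\circ s_i=w$ otherwise; likewise $s_i\circ w=s_iw$ if $w\lessdot s_iw$ and $s_i\circ w=w$ otherwise. Let $\mu=(\mu_1,\dots,\mu_k)$ be a composition of $n$ and $m_b=\mu_1+\dots+\mu_{b-1}$. For $\pi\in S_n$ the $b$-th block is the word $B_b=\pi(m_b+1)\cdots\pi(m_b+\mu_b)$, and its standardization $\mathrm{std}(B_b)\in S_{\mu_b}$ is the permutation in the same relative order. Call $\pi$ a $\mu$-involution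 if $\mathrm{std}(B_b)^2=e$ for every $b$, and let $\mathcal I_\mu$ be the set of $\mu$-involutions. Put $$\pi\circ_\mu s_i=\begin{cases}s_i\circ\pi & \text{if the values } i,i+1 \text{ lie in different blocks of } \pi,\\ (s_i\circ\pi)\circ s_{m_b+r} & \text{if the values } i,i+1 \text{ lie in the same block } B_b,\end{cases}$$ where $r$ is the rank of the value $i$ among the letters of $B_b$. A $\mu$-word for $\pi\in\mathcal I_\mu$ is a word $(a_1,\dots,a_p)$ with $\pi=(\cdots((e\circ_\mu s_{a_1})\circ_\mu s_{a_2})\cdots)\circ_\mu s_{a_p}$; it is reduced if $p$ is minimal. The set $\mathcal A_\mu(\pi)$ of $\mu$-atoms of $\pi$ consists of the $w\in S_n$ that have a reduced word which is a reduced $\mu$-word for $\pi$. For $i,j\in[n]$ the operator $t^\mu_{ij}$ on $\mathcal I_\mu$ is defined as follows: if there are $v\in\mathcal A_\mu(\pi)$ and $\tau\in\mathcal I_\mu$ with $v\lessdot vt_{ij}$ and $vt_{ij}\in\mathcal A_\mu(\tau)$, then $t^\mu_{ij}(\pi)=\tau$; otherwise $t^\mu_{ij}(\pi)=\pi$. **Lemma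 3.8.** For every composition $\mu$ of $n$ and all $i,j\in[n]$, the operator $t^\mu_{ij}:\mathcal I_\mu\to\mathcal I_\mu$ is well defined, that is, the rule above assigns exactly one $\mu$-involution to each $\pi\in\mathcal I_\mu$. In particular, if $\pi,\sigma,\tau\in\mathcal I_\mu$ and $u,v\in\mathcal A_\mu(\pi)$ satisfy $u\lessdot ut_{ij}$, $v\lessdot vt_{ij}$, $ut_{ij}\in\mathcal A_\mu(\sigma)$ and $vt_{ij}\in\mathcal A_\mu(\tau)$, then $\sigma=\tau$. -/

import Mathlib

namespace MuInv

/-! Permutations of `{1, …, n}` are elements of `Equiv.Perm (Fin n)`, with values and positions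
shifted down by one.  The product `u * v` is composition of functions, so that
`w * Equiv.swap i j` is `w` with the values in positions `i` and `j` exchanged. -/

/-! ### Reduced words, length and Bruhat covers in the symmetric group -/

/-- Indices of the simple transpositions of `S_n`. -/
abbrev Letter (n : ℕ) : Type := {i : ℕ // i + 1 < n}

/-- The smaller of the two points moved by `s_i`. -/
def Letter.lo {n : ℕ} (i : Letter n) : Fin n := ⟨i.1, Nat.lt_of_succ_lt i.2⟩

/-- The larger of the two points moved by `s_i`. -/
def Letter.hi {n : ℕ} (i : Letter n) : Fin n := ⟨i.1 + 1, i.2⟩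

/-- The simple transposition `s_i = (i, i + 1)`. -/
def simple {n : ℕ} (i : Letter n) : Equiv.Perm (Fin n) := Equiv.swap i.lo i.hi

/-- The product `s_{a_1} ⋯ s_{a_p}` in `S_n`. -/
def wordProd {n : ℕ} (a : List (Letter n)) : Equiv.Perm (Fin n) := (a.map simple).prod

/-- The length of `w`: the least number of factors in an expression of `w` as a product of simple
transpositions. -/
noncomputable def len {n : ℕ} (w : Equiv.Perm (Fin n)) : ℕ :=
  sInf {p : ℕ | ∃ a : List (Letter n), wordProd a = w ∧ a.length = p}

/-- The set `R(w)` of reduced words of `w`. -/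
def reducedWords {n : ℕ} (w : Equiv.Perm (Fin n)) : Set (List (Letter n)) :=
  {a | wordProd a = w ∧ a.length = len w}

/-- The cover relation `v ⋖ w` of the strong Bruhat order: `w = v t_{ij}` for some transposition
`t_{ij}`, and `ℓ(w) = ℓ(v) + 1`. -/
def BruhatCover {n : ℕ} (v w : Equiv.Perm (Fin n)) : Prop :=
  (∃ i j : Fin n, i ≠ j ∧ w = v * Equiv.swap i j) ∧ len w = len v + 1

/-! ### The 0-Hecke product with a simple transposition -/

open Classical in
/-- `w ∘ s_i` in the 0-Hecke monoid. -/
noncomputable def heckeRight {n : ℕ} (w : Equiv.Perm (Fin n)) (i : Letter n) :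
    Equiv.Perm (Fin n) :=
  if BruhatCover w (w * simple i) then w * simple i else w

open Classical in
/-- `s_i ∘ w` in the 0-Hecke monoid. -/
noncomputable def heckeLeft {n : ℕ} (i : Letter n) (w : Equiv.Perm (Fin n)) :
    Equiv.Perm (Fin n) :=
  if BruhatCover w (simple i * w) then simple i * w else w

/-! ### Blocks and `μ`-involutions -/

/-- The standardization of a word `f(1) ⋯ f(k)` with distinct letters: the permutation of
`{1, …, k}` in the same relative order (see `std_lt_std_iff`). -/
def std {k n : ℕ} (f : Fin k → Fin n) : Equiv.Perm (Fin k) := (Tuple.sort f)⁻¹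

theorem std_lt_std_iff {k n : ℕ} {f : Fin k → Fin n} (hf : Function.Injective f) (p q : Fin k) :
    std f p < std f q ↔ f p < f q := by
  have hm : StrictMono (f ∘ Tuple.sort f) :=
    (Tuple.monotone_sort f).strictMono_of_injective (hf.comp (Tuple.sort f).injective)
  have h := hm.lt_iff_lt (a := std f p) (b := std f q)
  simpa [std] using h.symm

/-- The `B`-th block of `(π, μ)`: the word of the values of `π` at the positions in the `B`-th
interval of the composition `μ`. -/
def block {n : ℕ} (μ : Composition n) (π : Equiv.Perm (Fin n)) (B : Fin μ.length) :
    Fin (μ.blocksFun B) → Fin n :=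
  fun p => π (μ.embedding B p)

theorem block_injective {n : ℕ} (μ : Composition n) (π : Equiv.Perm (Fin n))
    (B : Fin μ.length) : Function.Injective (block μ π B) :=
  π.injective.comp (μ.embedding B).injective

/-- The set `I_μ` of `μ`-involutions: the permutations all of whose blocks standardize to
involutions. -/
def muInvolutions {n : ℕ} (μ : Composition n) : Set (Equiv.Perm (Fin n)) :=
  {π | ∀ B : Fin μ.length, (std (block μ π B))⁻¹ = std (block μ π B)}

/-- The index of the block of `(π, μ)` that contains the value `a`. -/
def blockOf {n : ℕ} (μ : Composition n) (π : Equiv.Perm (Fin n)) (a : Fin n) : Fin μ.length :=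
  μ.index (π⁻¹ a)

/-- The relative value of `a` in the block of `(π, μ)` that contains it. -/
def relValue {n : ℕ} (μ : Composition n) (π : Equiv.Perm (Fin n)) (a : Fin n) :
    Fin (μ.blocksFun (blockOf μ π a)) :=
  std (block μ π (blockOf μ π a)) (μ.invEmbedding (π⁻¹ a))

theorem relValue_bound {n : ℕ} (μ : Composition n) (π : Equiv.Perm (Fin n)) (i : Letter n)
    (h : blockOf μ π i.lo = blockOf μ π i.hi) :
    (μ.embedding (blockOf μ π i.lo) (relValue μ π i.lo)).val + 1 < n := by
  have h2 : π⁻¹ i.hi ∈ Set.range (μ.embedding (blockOf μ π i.lo)) := by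
    rw [h]; exact μ.mem_range_embedding _
  obtain ⟨q, hq⟩ := h2
  have h1 : μ.embedding (blockOf μ π i.lo) (μ.invEmbedding (π⁻¹ i.lo)) = π⁻¹ i.lo :=
    μ.embedding_comp_inv _
  have h3 : relValue μ π i.lo < std (block μ π (blockOf μ π i.lo)) q := by
    refine (std_lt_std_iff (block_injective μ π _) _ _).2 ?_
    have e1 : block μ π (blockOf μ π i.lo) (μ.invEmbedding (π⁻¹ i.lo)) = i.lo := by
      unfold block; rw [h1]; simp
    have e2 : block μ π (blockOf μ π i.lo) q = i.hi := by
      unfold block; rw [hq]; simp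
    rw [e1, e2]
    exact Nat.lt_succ_self i.1
  have h4 := (μ.embedding (blockOf μ π i.lo)).strictMono h3
  exact lt_of_le_of_lt (Nat.succ_le_of_lt h4) (Fin.isLt _)

/-- When the values `i` and `i + 1` lie in the same block `B` of `(π, μ)`, the simple transposition
`s_{r_B(i)}` of the factor of `S_μ` that belongs to `B`, as a simple transposition of `S_n`: it
exchanges the positions of `B` whose ranks within `B` are `r_B(i)` and `r_B(i) + 1`. -/
def relLetter {n : ℕ} (μ : Composition n) (π : Equiv.Perm (Fin n)) (i : Letter n)
    (h : blockOf μ π i.lo = blockOf μ π i.hi) : Letter n :=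
  ⟨(μ.embedding (blockOf μ π i.lo) (relValue μ π i.lo)).val, relValue_bound μ π i h⟩

/-- The operation `π ∘_μ s_i`. -/
noncomputable def muAct {n : ℕ} (μ : Composition n) (π : Equiv.Perm (Fin n)) (i : Letter n) :
    Equiv.Perm (Fin n) :=
  if h : blockOf μ π i.lo = blockOf μ π i.hi then
    heckeRight (heckeLeft i π) (relLetter μ π i h)
  else heckeLeft i π

/-! ### `μ`-words and `μ`-atoms -/

/-- `a` is a `μ`-word for `π`, that is `π = e ∘_μ s_{a_1} ∘_μ ⋯ ∘_μ s_{a_p}`. -/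
def IsMuWord {n : ℕ} (μ : Composition n) (a : List (Letter n)) (π : Equiv.Perm (Fin n)) : Prop :=
  a.foldl (muAct μ) 1 = π

/-- `ℓ_μ(π)`: the least length of a `μ`-word for `π`. -/
noncomputable def muLen {n : ℕ} (μ : Composition n) (π : Equiv.Perm (Fin n)) : ℕ :=
  sInf {p : ℕ | ∃ a : List (Letter n), IsMuWord μ a π ∧ a.length = p}

/-- The set `R_μ(π)` of reduced `μ`-words for `π`. -/
def muReducedWords {n : ℕ} (μ : Composition n) (π : Equiv.Perm (Fin n)) :
    Set (List (Letter n)) :=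
  {a | IsMuWord μ a π ∧ a.length = muLen μ π}

/-- The set `A_μ(π)` of `μ`-atoms of `π`: the permutations that have a reduced word which is a
reduced `μ`-word for `π`. -/
def muAtoms {n : ℕ} (μ : Composition n) (π : Equiv.Perm (Fin n)) : Set (Equiv.Perm (Fin n)) :=
  {w | ∃ a, a ∈ reducedWords w ∧ a ∈ muReducedWords μ π}

/-! ### The transposition-like operators -/

/-- Some `μ`-atom `v` of `π` goes up by a Bruhat cover `v ⋖ v t_{ij}` to a `μ`-atom of `τ`. -/
def AtomCover {n : ℕ} (μ : Composition n) (i j : Fin n) (π τ : Equiv.Perm (Fin n)) : Prop :=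
  ∃ v ∈ muAtoms μ π, BruhatCover v (v * Equiv.swap i j) ∧ v * Equiv.swap i j ∈ muAtoms μ τ

/-- `τ` is a value that the definition of `t^μ_{ij}` assigns to `π`: either a `μ`-atom of `π` goes
up by a cover under `t_{ij}` to a `μ`-atom of `τ`, or there is no such cover, to a `μ`-atom of any
`μ`-involution, and `τ = π`. -/
def IsTransposeValue {n : ℕ} (μ : Composition n) (i j : Fin n) (π τ : muInvolutions μ) : Prop :=
  AtomCover μ i j π.1 τ.1 ∨ ((¬ ∃ σ : muInvolutions μ, AtomCover μ i j π.1 σ.1) ∧ τ = π)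

end MuInv

/-! Regard a `μ`-atom `w` of `π` as the word with the letter `a` in position `w a`, and write
`π⁻¹ = U ∘ y`, where `U` is increasing on the blocks and `y` is an involution of the letters that
preserves them.  By induction along a reduced word, `w` puts each letter into its block of `π` and
satisfies pattern conditions with respect to `y`.

If `w t_{ij}` is an atom too, with involution `z`, then counting the larger and the smaller letters
that occur before a given letter shows that `y` and `z` agree away from the cycles of `i` and `j`
under `y`.  On these at most four letters, `z` is determined by `y` and the blocks.  If `i` and `j`
lie in different blocks, then `i` takes the place of `j`, so that `y j` is the only letter that `z`
can pair with `i`, and it does so according to the relative order of the two letters, which `y`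
determines; likewise for `j` and `y i`.  If `i` and `j` share a block, then the finitely many
relative orders can be checked.  As the blocks are those of `π`, the choice of `w` does not
matter. -/

namespace MuInv

open Equiv

section Simple

variable {n : ℕ} {i : Letter n}

theorem Letter.lo_lt_hi (i : Letter n) : i.lo < i.hi := Nat.lt_succ_self i.1

theorem Letter.lo_covBy_hi (i : Letter n) : i.lo ⋖ i.hi :=
  ⟨i.lo_lt_hi, fun _ h h' => (Nat.succ_le_of_lt h).not_gt h'⟩

theorem simple_apply_lo (i : Letter n) : simple i i.lo = i.hi := swap_apply_left _ _

theorem simple_apply_hi (i : Letter n) : simple i i.hi = i.lo := swap_apply_right _ _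

theorem simple_simple (i : Letter n) (a : Fin n) : simple i (simple i a) = a :=
  swap_apply_self _ _ _

theorem simple_mul_self (i : Letter n) : simple i * simple i = 1 := swap_mul_self _ _

theorem simple_inv (i : Letter n) : (simple i)⁻¹ = simple i := swap_inv _ _

theorem simple_lt_simple_iff {a b : Fin n} :
    simple i a < simple i b ↔
      a < b ∧ ¬(a = i.lo ∧ b = i.hi) ∨ a = i.hi ∧ b = i.lo := by
  have hlo : i.lo.1 = i.1 := rfl
  have hhi : i.hi.1 = i.1 + 1 := rfl
  simp only [simple, swap_apply_def]
  grind

theorem comp_simple_eq {γ : Type*} {f : Fin n → γ} (h : f i.lo = f i.hi) (a : Fin n) :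
    f (simple i a) = f a := by
  simp only [simple, swap_apply_def]
  grind

end Simple

section Inversions

variable {α : Type*} [LinearOrder α] [Fintype α]

/-- The inversions of a permutation, as pairs of positions in increasing order. -/
def inversions (w : Perm α) : Finset (α × α) := {p | p.1 < p.2 ∧ w p.2 < w p.1}

theorem mem_inversions {w : Perm α} {p : α × α} :
    p ∈ inversions w ↔ p.1 < p.2 ∧ w p.2 < w p.1 := by simp [inversions]

theorem inversions_one : inversions (1 : Perm α) = ∅ :=
  Finset.eq_empty_of_forall_notMem fun _ hp =>
    lt_asymm (mem_inversions.1 hp).1 (mem_inversions.1 hp).2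

theorem card_inversions_inv (w : Perm α) : (inversions w⁻¹).card = (inversions w).card :=
  Finset.card_nbij' (fun p => (w⁻¹ p.2, w⁻¹ p.1)) (fun p => (w p.2, w p.1))
    (fun p => by simp +contextual [mem_inversions]) (fun p => by simp +contextual [mem_inversions])
    (fun p => by simp) (fun p => by simp)

theorem card_inversions_lt_mul_swap {w : Perm α} {i j : α} (hij : i < j) (hw : w i < w j) :
    (inversions w).card < (inversions (w * swap i j)).card := by
  set t := swap i j with ht
  have htt : ∀ a, t (t a) = a := swap_apply_self i j
  let φ : α × α → α × α := fun p => if t p.1 < t p.2 then (t p.1, t p.2) else p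
  have hφ : ∀ p ∈ inversions w, φ p ∈ (inversions (w * t)).erase (i, j) := by
    rintro ⟨a, b⟩ h
    simp only [φ, Finset.mem_erase, mem_inversions, Perm.mul_apply] at h ⊢
    split_ifs with hab
    · refine ⟨fun e => ?_, hab, by simpa only [htt] using h.2⟩
      have ha : a = j := by rw [← htt a, (Prod.mk.inj e).1, ht, swap_apply_left]
      have hb : b = i := by rw [← htt b, (Prod.mk.inj e).2, ht, swap_apply_right]
      exact hij.not_gt (ha ▸ hb ▸ h.1)
    · simp only [ht, swap_apply_def] at hab ⊢
      grind
  have hφ_inj : Set.InjOn φ (inversions w) := by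
    rintro ⟨a, b⟩ h ⟨c, d⟩ h' e
    simp only [Finset.mem_coe, mem_inversions] at h h'
    grind
  refine (Finset.card_le_card_of_injOn φ hφ hφ_inj).trans_lt (Finset.card_erase_lt_of_mem ?_)
  simpa [mem_inversions, t] using ⟨hij, hw⟩

end Inversions

section Length

variable {n : ℕ} {w : Perm (Fin n)} {i : Letter n}

theorem card_inversions_mul_simple (h : w i.lo < w i.hi) :
    (inversions (w * simple i)).card = (inversions w).card + 1 := by
  have hmem : (i.lo, i.hi) ∈ inversions (w * simple i) := by
    simpa [mem_inversions, simple_apply_lo, simple_apply_hi] using ⟨i.lo_lt_hi, h⟩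
  rw [← Finset.card_erase_add_one hmem, Nat.add_right_cancel_iff]
  refine Finset.card_nbij' (Prod.map (simple i) (simple i)) (Prod.map (simple i) (simple i))
    ?_ ?_ (fun p _ => Prod.ext (simple_simple i p.1) (simple_simple i p.2))
    (fun p _ => Prod.ext (simple_simple i p.1) (simple_simple i p.2))
  · rintro ⟨a, b⟩ hab
    simp only [Finset.coe_erase, Set.mem_sdiff, Finset.mem_coe, mem_inversions,
      Set.mem_singleton_iff, Prod.mk.injEq, Perm.mul_apply, Prod.map, simple_lt_simple_iff] at hab ⊢
    exact ⟨.inl ⟨hab.1.1, hab.2⟩, hab.1.2⟩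
  · rintro ⟨a, b⟩ hab
    simp only [Finset.coe_erase, Set.mem_sdiff, Finset.mem_coe, mem_inversions,
      Set.mem_singleton_iff, Prod.mk.injEq, Perm.mul_apply, Prod.map, simple_lt_simple_iff,
      simple_simple] at hab ⊢
    refine ⟨⟨.inl ⟨hab.1, ?_⟩, hab.2⟩, ?_⟩
    · rintro ⟨rfl, rfl⟩
      exact h.not_gt hab.2
    · rintro ⟨ha, hb⟩
      have := hab.1
      rw [← simple_simple i a, ← simple_simple i b, ha, hb, simple_apply_lo,
        simple_apply_hi] at this
      exact i.lo_lt_hi.not_gt this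

theorem card_inversions_mul_simple_of_gt (h : w i.hi < w i.lo) :
    (inversions w).card = (inversions (w * simple i)).card + 1 := by
  simpa [mul_assoc, simple_mul_self, simple_apply_lo, simple_apply_hi, h] using
    card_inversions_mul_simple (w := w * simple i) (i := i)

theorem card_inversions_mul_simple_le (w : Perm (Fin n)) (i : Letter n) :
    (inversions (w * simple i)).card ≤ (inversions w).card + 1 := by
  rcases lt_or_gt_of_ne (w.injective.ne i.lo_lt_hi.ne) with h | h
  · exact (card_inversions_mul_simple h).le
  · have := card_inversions_mul_simple_of_gt h
    omega

theorem wordProd_append_singleton (a : List (Letter n)) (i : Letter n) :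
    wordProd (a ++ [i]) = wordProd a * simple i := by
  simp [wordProd]

theorem card_inversions_wordProd_le (a : List (Letter n)) :
    (inversions (wordProd a)).card ≤ a.length := by
  induction a using List.reverseRecOn with
  | nil => exact (congrArg Finset.card inversions_one).le
  | append_singleton a i ih =>
    rw [wordProd_append_singleton, List.length_append, List.length_singleton]
    exact (card_inversions_mul_simple_le _ _).trans (Nat.add_le_add_right ih 1)

theorem eq_id_of_strictMono {f : Fin n → Fin n} (hf : StrictMono f) : f = id :=
  (hf.range_inj strictMono_id).1 <| by
    rw [(Finite.surjective_of_injective hf.injective).range_eq, Set.range_id]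

theorem exists_descent (h : w ≠ 1) : ∃ i : Letter n, w i.hi < w i.lo := by
  contrapose! h
  have hw : StrictMono w := by
    rcases n with _ | n
    · exact fun a => a.elim0
    · refine Fin.strictMono_iff_lt_succ.2 fun k => ?_
      exact (h ⟨k, Nat.succ_lt_succ k.2⟩).lt_of_ne (w.injective.ne k.castSucc_lt_succ.ne)
  exact Equiv.ext (congrFun (eq_id_of_strictMono hw))

theorem exists_wordProd_eq (w : Perm (Fin n)) :
    ∃ a : List (Letter n), wordProd a = w ∧ a.length = (inversions w).card := by
  by_cases hw : w = 1
  · exact ⟨[], hw.symm, by rw [hw, inversions_one]; rfl⟩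
  · obtain ⟨i, hi⟩ := exists_descent hw
    have hcard := card_inversions_mul_simple_of_gt hi
    obtain ⟨a, ha, hlen⟩ := exists_wordProd_eq (w * simple i)
    exact ⟨a ++ [i], by rw [wordProd_append_singleton, ha, mul_assoc, simple_mul_self, mul_one],
      by rw [List.length_append, List.length_singleton, hlen, hcard]⟩
termination_by (inversions w).card

theorem len_eq_card_inversions (w : Perm (Fin n)) : len w = (inversions w).card := by
  obtain ⟨a, ha, hlen⟩ := exists_wordProd_eq w
  refine le_antisymm (Nat.sInf_le ⟨a, ha, hlen⟩) (le_csInf ⟨_, a, ha, rfl⟩ ?_)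
  rintro p ⟨b, rfl, rfl⟩
  exact card_inversions_wordProd_le b

theorem len_wordProd_le (a : List (Letter n)) : len (wordProd a) ≤ a.length :=
  Nat.sInf_le ⟨a, rfl, rfl⟩

theorem bruhatCover_mul_simple_iff : BruhatCover w (w * simple i) ↔ w i.lo < w i.hi := by
  simp only [BruhatCover, len_eq_card_inversions]
  refine ⟨fun h => ?_, fun h => ⟨⟨i.lo, i.hi, i.lo_lt_hi.ne, rfl⟩, card_inversions_mul_simple h⟩⟩
  by_contra h'
  have := card_inversions_mul_simple_of_gt
    ((not_lt.1 h').lt_of_ne (w.injective.ne i.lo_lt_hi.ne'))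
  omega

theorem bruhatCover_inv_iff {v w : Perm (Fin n)} : BruhatCover v⁻¹ w⁻¹ ↔ BruhatCover v w := by
  have key : ∀ {v w : Perm (Fin n)}, BruhatCover v w → BruhatCover v⁻¹ w⁻¹ := by
    rintro v _ ⟨⟨i, j, hij, rfl⟩, hlen⟩
    refine ⟨⟨v i, v j, v.injective.ne hij, ?_⟩, ?_⟩
    · rw [swap_apply_apply, mul_inv_rev, swap_inv]
      group
    · simpa only [len_eq_card_inversions, card_inversions_inv] using hlen
  exact ⟨fun h => by simpa only [inv_inv] using key h, key⟩

theorem bruhatCover_simple_mul_iff :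
    BruhatCover w (simple i * w) ↔ w⁻¹ i.lo < w⁻¹ i.hi := by
  rw [← bruhatCover_mul_simple_iff, ← bruhatCover_inv_iff, mul_inv_rev, simple_inv]

end Length

/-- The combinatorial form of the cover `w ⋖ w t_{ij}` for `i < j`. -/
structure CoverSwap {α β : Type*} [LT α] [LT β] (w : α → β) (i j : α) : Prop where
  lt : i < j
  apply_lt : w i < w j
  not_between : ∀ k, i < k → k < j → ¬(w i < w k ∧ w k < w j)

theorem BruhatCover.coverSwap {n : ℕ} {w : Perm (Fin n)} {i j : Fin n} (hij : i < j)
    (h : BruhatCover w (w * swap i j)) : CoverSwap w i j := by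
  have hcard : (inversions (w * swap i j)).card = (inversions w).card + 1 := by
    simpa only [len_eq_card_inversions] using h.2
  refine ⟨hij, ?_, fun k hik hkj ⟨h₁, h₂⟩ => ?_⟩
  · by_contra hw
    have := card_inversions_lt_mul_swap (w := w * swap i j) hij (by
      simpa using (not_lt.1 hw).lt_of_ne (w.injective.ne hij.ne'))
    rw [mul_assoc, swap_mul_self, mul_one] at this
    omega
  · have hconj : swap i j = swap i k * swap k j * swap i k := by
      rw [swap_comm i k, swap_comm k j, swap_mul_swap_mul_swap hkj.ne' hij.ne']
    have hi : swap k j i = i := swap_apply_of_ne_of_ne hik.ne hij.ne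
    have hj : swap i k j = j := swap_apply_of_ne_of_ne hij.ne' hkj.ne'
    have up₁ := card_inversions_lt_mul_swap hik h₁
    have up₂ := card_inversions_lt_mul_swap (w := w * swap i k) hkj (by
      simpa [hj] using h₁.trans h₂)
    have up₃ := card_inversions_lt_mul_swap (w := w * swap i k * swap k j) hik (by
      simpa [hi, hj] using h₂)
    simp only [hconj, ← mul_assoc] at hcard
    omega

/-- The pattern conditions satisfied by the atoms of a `μ`-involution.  Here `w` is a word, read as
the map from letters to positions, whose positions are grouped into blocks by `g`, and `y` is an
involution of the letters.  The cycles of `y` lie inside the blocks; the larger letter of a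
two-cycle comes first, with no letter of intermediate value in between; and of two cycles
`{a ≤ y a}` and `{c ≤ y c}` of the same block with `a < c` and `y a < y c`, the first occurs before
the second. -/
structure AtomLike {α β ι : Type*} [LinearOrder α] [LinearOrder β] (g : β → ι) (w : α → β)
    (y : α → α) : Prop where
  inj : Function.Injective w
  invol : Function.Involutive y
  block_eq : ∀ a, g (w (y a)) = g (w a)
  desc : ∀ a, a < y a → w (y a) < w a
  not_between : ∀ a t, a < t → t < y a → ¬(w (y a) < w t ∧ w t < w a)
  order : ∀ a c, g (w a) = g (w c) → a ≤ y a → c ≤ y c → a < c → y a < y c → w a < w (y c)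

namespace AtomLike

variable {α β ι : Type*} [LinearOrder α] [LinearOrder β] {g : β → ι} {w : α → β} {y : α → α}

theorem refl (g : β → ι) {w : α → β} (hw : StrictMono w) : AtomLike g w id where
  inj := hw.injective
  invol _ := rfl
  block_eq _ := rfl
  desc _ h := absurd h (lt_irrefl _)
  not_between _ _ h h' := absurd (h.trans h') (lt_irrefl _)
  order _ _ _ _ _ h _ := hw h

theorem desc' (h : AtomLike g w y) {a : α} (ha : y a < a) : w a < w (y a) := by
  simpa only [h.invol a] using h.desc (y a) (by rwa [h.invol])

theorem not_between' (h : AtomLike g w y) {a t : α} (h₁ : y a < t) (h₂ : t < a) :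
    ¬(w a < w t ∧ w t < w (y a)) := by
  simpa only [h.invol a] using h.not_between (y a) t h₁ (by rwa [h.invol])

theorem order' (h : AtomLike g w y) {a c : α} (hg : g (w a) = g (w c)) (ha : y a ≤ a)
    (hc : y c ≤ c) (hca : c < a) (hy : y c < y a) : w (y c) < w a := by
  simpa only [h.invol a] using h.order (y c) (y a) (by rw [h.block_eq, h.block_eq, hg])
    (by rwa [h.invol]) (by rwa [h.invol]) hy (by rwa [h.invol, h.invol])

theorem apply_le_apply (h : AtomLike g w y) {a : α} (ha : a ≤ y a) : w (y a) ≤ w a :=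
  ha.eq_or_lt.elim (fun e => (congrArg w e).ge) fun ha => (h.desc a ha).le

/-- Reversing both words and letters preserves the pattern conditions, which turns every fact below
about the letters before `a` into one about the letters after `a`. -/
theorem dual (h : AtomLike g w y) : AtomLike (α := αᵒᵈ) (β := βᵒᵈ) g w y where
  inj := h.inj
  invol := h.invol
  block_eq := h.block_eq
  desc _ ha := h.desc' ha
  not_between _ _ h₁ h₂ h₃ := h.not_between' h₂ h₁ h₃.symm
  order _ _ hg ha hc hac hy := h.order' hg ha hc hac hy

theorem partner_lt (h : AtomLike g w y) {a x : α} (hax : a < x) (hg : g (w x) = g (w a))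
    (hx : w x < w a) (hlow : a < y a → w (y a) < w x) :
    y x < a ∧ w x < w (y x) ∧ w (y x) < w a := by
  -- `p` is the smaller letter of the cycle of `a`.
  obtain ⟨p, hp, hpa, hpx, hwp, hgp⟩ :
      ∃ p, p ≤ y p ∧ p ≤ a ∧ y p < x ∧ w a ≤ w p ∧ g (w p) = g (w a) := by
    rcases le_or_gt (y a) a with ha | ha
    · refine ⟨y a, ?_, ha, ?_, ?_, h.block_eq a⟩
      · rwa [h.invol]
      · rwa [h.invol]
      · simpa only [h.invol a] using h.apply_le_apply (a := y a) (by rwa [h.invol])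
    · refine ⟨a, ha.le, le_rfl, lt_of_not_ge fun hxa => ?_, le_rfl, rfl⟩
      exact h.not_between a x hax (hxa.lt_of_ne fun e => (hlow ha).ne (congrArg w e.symm))
        ⟨hlow ha, hx⟩
  have hwxp : w x < w p := hx.trans_le hwp
  have hyx : y x < x := by
    by_contra! hle
    have := h.order p x (by rw [hgp, hg]) hp hle (hpa.trans_lt hax) (hpx.trans_le hle)
    exact this.not_ge ((h.apply_le_apply hle).trans hwxp.le)
  have hyxa : y x < a := by
    by_contra! hle
    have hne : p ≠ y x := fun e => hpx.ne (by rw [e, h.invol])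
    have := h.order p (y x) (by rw [hgp, h.block_eq, hg]) hp (by rw [h.invol]; exact hyx.le)
      ((hpa.trans hle).lt_of_ne hne) (by rwa [h.invol])
    rw [h.invol] at this
    exact lt_asymm this hwxp
  refine ⟨hyxa, h.desc' hyx, ?_⟩
  by_contra! hle
  exact h.not_between' hyxa hax ⟨hx, hle.lt_of_ne (h.inj.ne hyxa.ne')⟩

theorem lt_partner (h : AtomLike g w y) {a x : α} (hxa : x < a) (hg : g (w x) = g (w a))
    (hx : w a < w x) (hhigh : y a < a → w x < w (y a)) :
    a < y x ∧ w (y x) < w x ∧ w a < w (y x) :=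
  h.dual.partner_lt hxa hg hx hhigh

end AtomLike

section Ballot

variable {α β : Type*} [Fintype α] [LinearOrder α] [LinearOrder β]

/-- The letters larger than `a` that occur at or after the position `d` and before `a`. -/
def largerBefore (w : α → β) (a : α) (d : β) : Finset α := {x | a < x ∧ d ≤ w x ∧ w x < w a}

/-- The letters smaller than `a` that occur at or after the position `d` and before `a`. -/
def smallerBefore (w : α → β) (a : α) (d : β) : Finset α := {x | x < a ∧ d ≤ w x ∧ w x < w a}

variable {w : α → β} {a x : α} {d : β}

theorem mem_largerBefore : x ∈ largerBefore w a d ↔ a < x ∧ d ≤ w x ∧ w x < w a := by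
  simp [largerBefore]

theorem mem_smallerBefore : x ∈ smallerBefore w a d ↔ x < a ∧ d ≤ w x ∧ w x < w a := by
  simp [smallerBefore]

variable {ι : Type*} [PartialOrder ι] {g : β → ι} {y : α → α}

theorem block_eq_of_le_of_le (hg : Monotone g) {p q r : β} (h : g p = g r) (hpq : p ≤ q)
    (hqr : q ≤ r) : g q = g r :=
  le_antisymm (hg hqr) (h ▸ hg hpq)

theorem AtomLike.card_largerBefore_le (hg : Monotone g) (h : AtomLike g w y) (hd : g d = g (w a))
    (hlow : a < y a → w (y a) < d) : (largerBefore w a d).card ≤ (smallerBefore w a d).card := by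
  refine Finset.card_le_card_of_injOn y (fun x hx => ?_) h.invol.injective.injOn
  obtain ⟨hax, hdx, hxa⟩ := mem_largerBefore.1 hx
  obtain ⟨h₁, h₂, h₃⟩ := h.partner_lt hax (block_eq_of_le_of_le hg hd hdx hxa.le) hxa
    fun ha => (hlow ha).trans_le hdx
  exact mem_smallerBefore.2 ⟨h₁, hdx.trans h₂.le, h₃⟩

theorem AtomLike.card_smallerBefore_lt (hg : Monotone g) (h : AtomLike g w y) (ha : a < y a) :
    (smallerBefore w a (w (y a))).card < (largerBefore w a (w (y a))).card := by
  refine (Finset.card_le_card_of_injOn (t := (largerBefore w a (w (y a))).erase (y a)) y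
    (fun x hx => ?_) h.invol.injective.injOn).trans_lt
    (Finset.card_erase_lt_of_mem (mem_largerBefore.2 ⟨ha, le_rfl, h.desc a ha⟩))
  obtain ⟨hxa, hdx, hxw⟩ := mem_smallerBefore.1 hx
  have hwx : w (y a) < w x := hdx.lt_of_ne (h.inj.ne (hxa.trans ha).ne')
  obtain ⟨h₁, h₂, h₃⟩ := h.lt_partner (hxa.trans ha)
    (by rw [block_eq_of_le_of_le hg (h.block_eq a) hdx hxw.le, h.block_eq]) hwx
    (by rw [h.invol]; exact fun _ => hxw)
  exact Finset.mem_erase.2 ⟨h.invol.injective.ne hxa.ne,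
    mem_largerBefore.2 ⟨ha.trans h₁, h₃.le, h₂.trans hxw⟩⟩

end Ballot

theorem comp_swap_apply_of_ne {α β : Type*} [DecidableEq α] (w : α → β) {i j a : α} (hi : a ≠ i)
    (hj : a ≠ j) : (w ∘ swap i j) a = w a :=
  congrArg w (swap_apply_of_ne_of_ne hi hj)

namespace CoverSwap

variable {α β : Type*} [LinearOrder α] [LinearOrder β] {w : α → β} {i j a b : α} {d : β}

theorem dual (h : CoverSwap w i j) : CoverSwap (α := αᵒᵈ) (β := βᵒᵈ) w j i :=
  ⟨h.lt, h.apply_lt, fun k hjk hki hk => h.not_between k hki hjk hk.symm⟩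

variable [Fintype α]

theorem card_before_eq (h : CoverSwap w i j) (hi : a ≠ i) (hj : a ≠ j) (ha : ¬(i < a ∧ a < j))
    (d : β) :
    (largerBefore (w ∘ swap i j) a d).card = (largerBefore w a d).card ∧
      (smallerBefore (w ∘ swap i j) a d).card = (smallerBefore w a d).card := by
  have hlt : ∀ x, (a < swap i j x ↔ a < x) ∧ (swap i j x < a ↔ x < a) := fun x => by
    have := h.lt
    simp only [swap_apply_def]
    grind
  constructor <;>
  · refine Finset.card_nbij' (swap i j) (swap i j) (fun x hx => ?_) (fun x hx => ?_)
      (fun x _ => swap_apply_self i j x) (fun x _ => swap_apply_self i j x) <;>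
    simpa only [Finset.mem_coe, mem_largerBefore, mem_smallerBefore,
      comp_swap_apply_of_ne w hi hj, Function.comp_apply, swap_apply_self, hlt] using hx

theorem card_largerBefore_le (h : CoverSwap w i j) (hw : Function.Injective w) (hi : a ≠ i)
    (hj : a ≠ j) (d : β) :
    (largerBefore (w ∘ swap i j) a d).card ≤ (largerBefore w a d).card := by
  by_cases ha : i < a ∧ a < j
  · refine Finset.card_le_card fun x hx => ?_
    have := h.not_between a ha.1 ha.2
    have := h.apply_lt
    have := hw.ne hj
    simp only [mem_largerBefore, comp_swap_apply_of_ne w hi hj, Function.comp_apply,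
      swap_apply_def] at hx ⊢
    grind
  · exact (h.card_before_eq hi hj ha d).1.le

theorem card_le_smallerBefore (h : CoverSwap w i j) (hw : Function.Injective w) (hi : a ≠ i)
    (hj : a ≠ j) (d : β) :
    (smallerBefore w a d).card ≤ (smallerBefore (w ∘ swap i j) a d).card := by
  by_cases ha : i < a ∧ a < j
  · refine Finset.card_le_card fun x hx => ?_
    have := h.not_between a ha.1 ha.2
    have := h.apply_lt
    have := hw.ne hj
    simp only [mem_smallerBefore, comp_swap_apply_of_ne w hi hj, Function.comp_apply,
      swap_apply_def] at hx ⊢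
    grind
  · exact (h.card_before_eq hi hj ha d).2.ge

/-- If `w b` and `w a` bound a stretch of the word without letters between `a` and `b`, then the
exchanged letters `i` and `j` lie both inside or both outside the stretch as soon as `i < a < j`. -/
theorem card_before_eq_of_not_between (h : CoverSwap w i j) (hi : a ≠ i) (hj : a ≠ j)
    (hbi : b ≠ i) (hbj : b ≠ j) (hw : Function.Injective w) (hab : a < b)
    (hbetween : ∀ t, a < t → t < b → ¬(w b < w t ∧ w t < w a)) :
    (largerBefore (w ∘ swap i j) a (w b)).card = (largerBefore w a (w b)).card ∧
      (smallerBefore (w ∘ swap i j) a (w b)).card = (smallerBefore w a (w b)).card := by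
  by_cases ha : i < a ∧ a < j
  · have hcover := h.apply_lt
    have hcover_a := h.not_between a ha.1 ha.2
    have hcover_b := h.not_between b (ha.1.trans hab)
    have := hw.ne hj
    have := hw.ne hbi
    have := hw.ne hbj
    have hoverlap : w i < w a → w b < w j → w b < w i ∧ w j < w a := fun hia hbj' => by
      rcases lt_or_gt_of_ne hbj with hlt | hlt
      · grind
      · have := hbetween j ha.2 hlt
        grind
    constructor <;>
    · congr 1
      ext x
      simp only [mem_largerBefore, mem_smallerBefore, comp_swap_apply_of_ne w hi hj,
        Function.comp_apply, swap_apply_def]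
      grind
  · exact h.card_before_eq hi hj ha _

end CoverSwap

/-- The atom-like pairs `(w, y)` and `(w t_{ij}, z)` are related by the cover `w ⋖ w t_{ij}`. -/
structure AtomSwap {α β ι : Type*} [LinearOrder α] [LinearOrder β] (g : β → ι) (i j : α)
    (w : α → β) (y z : α → α) : Prop where
  cover : CoverSwap w i j
  source : AtomLike g w y
  target : AtomLike g (w ∘ swap i j) z

namespace AtomSwap

variable {α β ι : Type*} [LinearOrder α] [LinearOrder β] {g : β → ι} {i j a : α} {w : α → β}
  {y z : α → α}

theorem dual (h : AtomSwap g i j w y z) : AtomSwap (α := αᵒᵈ) (β := βᵒᵈ) g j i w y z where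
  cover := h.cover.dual
  source := h.source.dual
  target :=
    have : AtomLike g (w ∘ swap j i) z := swap_comm i j ▸ h.target
    this.dual

variable [Finite α] [PartialOrder ι]

theorem lt_source_of_lt_target (hg : Monotone g) (h : AtomSwap g i j w y z) (hi : a ≠ i)
    (hj : a ≠ j) (ha : a < z a) : a < y a ∧ (w ∘ swap i j) (z a) ≤ w (y a) := by
  have := Fintype.ofFinite α
  by_contra! hlow
  have hblock := h.target.block_eq a
  rw [comp_swap_apply_of_ne w hi hj] at hblock
  have := calc
    (largerBefore w a ((w ∘ swap i j) (z a))).card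
    _ ≤ (smallerBefore w a ((w ∘ swap i j) (z a))).card :=
      h.source.card_largerBefore_le hg hblock hlow
    _ ≤ (smallerBefore (w ∘ swap i j) a ((w ∘ swap i j) (z a))).card :=
      h.cover.card_le_smallerBefore h.source.inj hi hj _
    _ < (largerBefore (w ∘ swap i j) a ((w ∘ swap i j) (z a))).card :=
      h.target.card_smallerBefore_lt hg ha
    _ ≤ (largerBefore w a ((w ∘ swap i j) (z a))).card :=
      h.cover.card_largerBefore_le h.source.inj hi hj _
  exact this.false

theorem lt_target_of_lt_source (hg : Monotone g) (h : AtomSwap g i j w y z) (hi : a ≠ i)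
    (hj : a ≠ j) (hyi : y a ≠ i) (hyj : y a ≠ j) (ha : a < y a) :
    a < z a ∧ w (y a) ≤ (w ∘ swap i j) (z a) := by
  have := Fintype.ofFinite α
  by_contra! hlow
  obtain ⟨hlarger, hsmaller⟩ := h.cover.card_before_eq_of_not_between hi hj hyi hyj h.source.inj ha
    (h.source.not_between a)
  have := calc
    (largerBefore w a (w (y a))).card
    _ = (largerBefore (w ∘ swap i j) a (w (y a))).card := hlarger.symm
    _ ≤ (smallerBefore (w ∘ swap i j) a (w (y a))).card :=
      h.target.card_largerBefore_le hg
        (by rw [comp_swap_apply_of_ne w hi hj, h.source.block_eq]) hlow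
    _ = (smallerBefore w a (w (y a))).card := hsmaller
    _ < (largerBefore w a (w (y a))).card := h.source.card_smallerBefore_lt hg ha
  exact this.false

theorem apply_eq (hg : Monotone g) (h : AtomSwap g i j w y z) (hi : a ≠ i) (hj : a ≠ j)
    (hyi : y a ≠ i) (hyj : y a ≠ j) : z a = y a := by
  have eq_of_lt : ∀ {b}, b ≠ i → b ≠ j → y b ≠ i → y b ≠ j → b < y b → z b = y b := by
    intro b hbi hbj hyi hyj hb
    have hz := h.lt_target_of_lt_source hg hbi hbj hyi hyj hb
    refine h.target.inj (((h.lt_source_of_lt_target hg hbi hbj hz.1).2.antisymm hz.2).trans ?_)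
    rw [comp_swap_apply_of_ne w hyi hyj]
  rcases lt_trichotomy a (y a) with ha | ha | ha
  · exact eq_of_lt hi hj hyi hyj ha
  · rw [← ha]
    refine le_antisymm (le_of_not_gt fun hz => ?_) (le_of_not_gt fun hz => ?_)
    · exact (h.lt_source_of_lt_target hg hi hj hz).1.ne ha
    · exact (h.dual.lt_source_of_lt_target hg.dual hj hi hz).1.ne ha
  · have := eq_of_lt hyi hyj (by rwa [h.source.invol]) (by rwa [h.source.invol])
      (by rwa [h.source.invol])
    rw [h.source.invol] at this
    rw [← this, h.target.invol, this]

end AtomSwap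

section Fixed

variable {n : ℕ} {y : Fin n → Fin n} {i : Letter n}

theorem simple_cases_of_fixed (hy : Function.Involutive y) (hlo : y i.lo = i.lo)
    (hhi : y i.hi = i.hi) (a : Fin n) :
    a = i.lo ∧ simple i a = i.hi ∧ simple i (y a) = i.hi ∨
      a = i.hi ∧ simple i (y a) = i.lo ∨
      (a ≠ i.lo ∧ a ≠ i.hi) ∧ (y a ≠ i.lo ∧ y a ≠ i.hi) ∧
        simple i a = a ∧ simple i (y a) = y a := by
  have := simple_apply_lo i
  have := simple_apply_hi i
  have : ∀ a, a ≠ i.lo → a ≠ i.hi → simple i a = a := fun a => swap_apply_of_ne_of_ne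
  have := hy a
  grind

theorem comp_simple_of_fixed (hy : Function.Involutive y) (hlo : y i.lo = i.lo)
    (hhi : y i.hi = i.hi) (a : Fin n) : y (simple i a) = simple i (y a) := by
  simpa only [simple, hlo, hhi, eq_comm] using hy.injective.swap_apply i.lo i.hi a

end Fixed

namespace AtomLike

variable {n : ℕ} {β ι : Type*} [LinearOrder β] {g : β → ι} {w : Fin n → β} {y : Fin n → Fin n}
  {i : Letter n}

section Conj

variable (h : AtomLike g w y)
  (hi : g (w i.lo) = g (w i.hi) → y i.lo < y i.hi ∧ ¬(y i.lo = i.lo ∧ y i.hi = i.hi))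
include h hi

theorem lt_of_simple_lt_simple {a : Fin n} (ha : simple i a < simple i (y a)) : a < y a := by
  rcases simple_lt_simple_iff.1 ha with ⟨ha, -⟩ | ⟨rfl, hya⟩
  · exact ha
  · have hlo : y i.lo = i.hi := hya ▸ h.invol i.hi
    have := (hi (by rw [← hya, h.block_eq])).1
    exact absurd i.lo_lt_hi (by rw [hlo, hya] at this; exact this.not_gt)

variable [PartialOrder ι] (hg : Monotone g)
include hg

theorem not_between_conj_simple {a t : Fin n} (hat : simple i a < simple i t)
    (hta : simple i t < simple i (y a)) : ¬(w (y a) < w t ∧ w t < w a) := by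
  rintro ⟨h₁, h₂⟩
  have hgt : g (w t) = g (w a) := block_eq_of_le_of_le hg (h.block_eq a) h₁.le h₂.le
  have hinv := h.invol a
  rcases simple_lt_simple_iff.1 hat with ⟨hat, -⟩ | ⟨rfl, rfl⟩
  · rcases simple_lt_simple_iff.1 hta with ⟨hta, -⟩ | ⟨rfl, hya⟩
    · exact h.not_between a t hat hta ⟨h₁, h₂⟩
    · rw [hya] at hinv h₁
      have hlohi : g (w i.lo) = g (w i.hi) := by rw [hgt, ← hinv, h.block_eq]
      exact (h.partner_lt hat hgt h₂ fun _ => hya ▸ h₁).1.not_gt (hinv ▸ (hi hlohi).1)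
  · rcases simple_lt_simple_iff.1 hta with ⟨hta, -⟩ | ⟨hta, -⟩
    · exact (h.lt_partner hta (by rw [hgt, h.block_eq]) h₁ fun _ => hinv.symm ▸ h₂).1.not_gt
        (hi hgt).1
    · exact absurd hta i.lo_lt_hi.ne

/-- A step of the `μ`-action that does not create a two-cycle conjugates the involution. -/
theorem conj_simple : AtomLike g (w ∘ simple i) (simple i ∘ y ∘ simple i) := by
  have hs := simple_simple i
  have hle : ∀ {a}, simple i a ≤ simple i (y a) → a ≤ y a := fun {a} ha =>
    ha.eq_or_lt.elim (fun e => ((simple i).injective e).le)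
      fun ha => (h.lt_of_simple_lt_simple hi ha).le
  refine ⟨h.inj.comp (simple i).injective, fun a => ?_, fun a => ?_, ?_, ?_, ?_⟩
  · simp only [Function.comp_apply, hs, h.invol _]
  · simp only [Function.comp_apply, hs, h.block_eq]
  all_goals refine (simple i).forall_congr_right.1 fun a => ?_
  · simp only [Function.comp_apply, hs]
    exact fun ha => h.desc _ (h.lt_of_simple_lt_simple hi ha)
  · refine (simple i).forall_congr_right.1 fun t => ?_
    simp only [Function.comp_apply, hs]
    exact h.not_between_conj_simple hi hg
  · refine (simple i).forall_congr_right.1 fun c => ?_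
    simp only [Function.comp_apply, hs]
    intro hac ha hc h₁ h₂
    rcases simple_lt_simple_iff.1 h₁ with ⟨h₁', -⟩ | ⟨rfl, rfl⟩
    · rcases simple_lt_simple_iff.1 h₂ with ⟨h₂, -⟩ | ⟨hya, hyc⟩
      · exact h.order _ _ hac (hle ha) (hle hc) h₁' h₂
      · have := (hi (by rw [← hya, ← hyc, h.block_eq, h.block_eq, hac])).1
        rw [← hya, ← hyc, h.invol, h.invol] at this
        exact absurd this h₁'.not_gt
    · have := hi hac.symm
      exact absurd h₂ (simple_lt_simple_iff.2 (.inl this)).not_gt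

end Conj

/-- A step of the `μ`-action at two fixed letters of the same block creates a two-cycle. -/
theorem simple_comp (h : AtomLike g w y) (hblock : g (w i.lo) = g (w i.hi)) (hw : w i.lo < w i.hi)
    (hlo : y i.lo = i.lo) (hhi : y i.hi = i.hi) :
    AtomLike g (w ∘ simple i) (simple i ∘ y) := by
  have hs := simple_simple i
  have hfix := simple_cases_of_fixed h.invol hlo hhi
  have hcomm := comp_simple_of_fixed h.invol hlo hhi
  have hg : ∀ a, g (w (simple i a)) = g (w a) := comp_simple_eq (f := g ∘ w) hblock
  have hcov := i.lo_covBy_hi.2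
  have hlohi := i.lo_lt_hi
  refine ⟨h.inj.comp (simple i).injective, fun a => ?_, fun a => ?_, fun a ha => ?_,
    fun a t h₁ h₂ => ?_, fun a c hac ha hc h₁ h₂ => ?_⟩
  all_goals simp only [Function.comp_apply, hs, hcomm, hg] at *
  · exact h.invol a
  · exact h.block_eq a
  · have := h.desc a
    grind
  · rcases hfix a with ⟨rfl, -, hya⟩ | ⟨rfl, hya⟩ | ⟨ha, hya, hsa, hsya⟩
    · exact absurd (hya ▸ h₂) (hcov h₁)
    · exact absurd (h₁.trans (hya ▸ h₂)) hlohi.not_gt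
    · rw [hsa]
      rw [hsya] at h₂
      exact h.not_between a _ (by grind) (by grind)
  · have horder := h.order a c hac
    rcases hfix a with ⟨rfl, hslo, -⟩ | ⟨rfl, hya⟩ | ⟨-, -, hsa, hsya⟩
    · have := hfix c
      have := h.order i.hi c
      grind
    · exact absurd (hya ▸ ha) hlohi.not_ge
    · rcases hfix c with ⟨rfl, -⟩ | ⟨rfl, hyc⟩ | -
      · grind
      · exact absurd (hyc ▸ hc) hlohi.not_ge
      · grind

end AtomLike

section Hecke

variable {n : ℕ} (w : Perm (Fin n)) (i : Letter n)

theorem heckeRight_eq : heckeRight w i = if w i.lo < w i.hi then w * simple i else w := by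
  simp only [heckeRight, bruhatCover_mul_simple_iff]

theorem heckeLeft_eq : heckeLeft i w = if w⁻¹ i.lo < w⁻¹ i.hi then simple i * w else w := by
  simp only [heckeLeft, bruhatCover_simple_mul_iff]

end Hecke

theorem index_monotone {n : ℕ} (μ : Composition n) : Monotone μ.index := by
  intro a b hab
  by_contra! hlt
  exact ((μ.lt_sizeUpTo_index_succ b).trans_le
    ((μ.monotone_sizeUpTo (Nat.succ_le_of_lt hlt)).trans (μ.sizeUpTo_index_le a))).not_ge hab

/-- A factorization `π⁻¹ = U ∘ y` of a `μ`-involution: `U a` is the position of the value `a` after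
the blocks of `π` have been sorted increasingly, and `y` is the involution of the values that acts
on the values of each block as the standardization of that block does on their ranks. -/
structure BlockForm {n : ℕ} (μ : Composition n) (π U : Perm (Fin n)) (y : Fin n → Fin n) :
    Prop where
  inv_apply : ∀ a, π⁻¹ a = U (y a)
  invol : Function.Involutive y
  block_eq : ∀ a, μ.index (U (y a)) = μ.index (U a)
  mono : ∀ a c, μ.index (U a) = μ.index (U c) → a < c → U a < U c

theorem eq_of_index_eq {n : ℕ} {μ : Composition n} {U : Perm (Fin n)} {V : Fin n → Fin n}
    (hidx : ∀ a, μ.index (V a) = μ.index (U a))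
    (hU : ∀ a c, μ.index (U a) = μ.index (U c) → a < c → U a < U c)
    (hV : ∀ a c, μ.index (U a) = μ.index (U c) → a < c → V a < V c) : V = U := by
  have hmono : StrictMono (V ∘ U.symm) := by
    refine fun p q hpq => ?_
    obtain ⟨a, rfl⟩ := U.surjective p
    obtain ⟨c, rfl⟩ := U.surjective q
    simp only [Function.comp_apply, Equiv.symm_apply_apply]
    rcases (index_monotone μ hpq.le).eq_or_lt with hac | hac
    · refine hV a c hac (lt_of_not_ge fun hca => ?_)
      rcases hca.eq_or_lt with rfl | hca
      · exact hpq.false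
      · exact hpq.asymm (hU c a hac.symm hca)
    · rw [← hidx, ← hidx] at hac
      exact (index_monotone μ).reflect_lt hac
  funext a
  simpa using congrFun (eq_id_of_strictMono hmono) (U a)

namespace BlockForm

variable {n : ℕ} {μ : Composition n} {π σ U U' : Perm (Fin n)} {y y' : Fin n → Fin n}
  {i : Letter n} {a c : Fin n}

theorem one (μ : Composition n) : BlockForm μ 1 1 id where
  inv_apply _ := rfl
  invol _ := rfl
  block_eq _ := rfl
  mono _ _ _ h := h

theorem blockOf_eq (h : BlockForm μ π U y) (a : Fin n) : blockOf μ π a = μ.index (U a) := by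
  rw [blockOf, h.inv_apply, h.block_eq]

theorem left_unique (h : BlockForm μ π U y) (h' : BlockForm μ σ U' y')
    (hidx : ∀ a, μ.index (U' a) = μ.index (U a)) : U' = U :=
  Equiv.coe_fn_injective (eq_of_index_eq hidx h.mono
    fun a c hac => h'.mono a c (by rw [hidx, hidx, hac]))

theorem right_unique (h : BlockForm μ π U y) (h' : BlockForm μ π U' y') : y = y' := by
  obtain rfl := h.left_unique h' fun a => by rw [← h.blockOf_eq, ← h'.blockOf_eq]
  exact funext fun a => U'.injective (by rw [← h.inv_apply, ← h'.inv_apply])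

theorem perm_unique (h : BlockForm μ π U y) (h' : BlockForm μ σ U' y)
    (hidx : ∀ a, μ.index (U' a) = μ.index (U a)) : π = σ := by
  obtain rfl := h.left_unique h' hidx
  exact inv_injective (Equiv.ext fun a => by rw [h.inv_apply, h'.inv_apply])

theorem lt_iff_lt (h : BlockForm μ π U y) (hac : μ.index (U a) = μ.index (U c)) :
    U a < U c ↔ a < c := by
  refine ⟨fun hlt => lt_of_not_ge fun hca => ?_, h.mono a c hac⟩
  rcases hca.eq_or_lt with rfl | hca
  · exact hlt.false
  · exact hlt.asymm (h.mono c a hac.symm hca)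

theorem apply_apply (h : BlockForm μ π U y) (a : Fin n) : π (U a) = y a := by
  rw [← Perm.eq_inv_iff_eq, h.inv_apply, h.invol]

theorem covBy (h : BlockForm μ π U y) (hi : μ.index (U i.lo) = μ.index (U i.hi)) :
    U i.lo ⋖ U i.hi := by
  refine ⟨h.mono _ _ hi i.lo_lt_hi, fun c hlo hhi => ?_⟩
  obtain ⟨x, rfl⟩ := U.surjective c
  have hx := block_eq_of_le_of_le (index_monotone μ) hi hlo.le hhi.le
  exact i.lo_covBy_hi.2 ((h.lt_iff_lt (hi.trans hx.symm)).1 hlo) ((h.lt_iff_lt hx).1 hhi)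

end BlockForm

theorem embedding_relValue {n : ℕ} (μ : Composition n) (π : Perm (Fin n)) {a : Fin n}
    {B : Fin μ.length} {q : Fin (μ.blocksFun B)} (h : π⁻¹ a = μ.embedding B q) :
    μ.embedding (blockOf μ π a) (relValue μ π a) = μ.embedding B (std (block μ π B) q) := by
  obtain rfl : B = blockOf μ π a := by rw [blockOf, h, μ.index_embedding]
  have : μ.invEmbedding (π⁻¹ a) = q :=
    (μ.embedding (blockOf μ π a)).injective ((μ.embedding_comp_inv _).trans h)
  rw [relValue, this]

namespace BlockForm

variable {n : ℕ} {μ : Composition n} {π U : Perm (Fin n)} {y : Fin n → Fin n} {i : Letter n}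

theorem embedding_relValue_eq (h : BlockForm μ π U y) :
    (fun a => μ.embedding (blockOf μ π a) (relValue μ π a)) = U := by
  refine eq_of_index_eq (μ := μ) (fun a => ?_) h.mono fun a c hac hlt => ?_
  · rw [μ.index_embedding, h.blockOf_eq]
  · rw [← h.blockOf_eq, ← h.blockOf_eq] at hac
    have hblock : ∀ b, ∃ q, μ.embedding (blockOf μ π b) q = π⁻¹ b := fun b =>
      μ.mem_range_embedding (π⁻¹ b)
    obtain ⟨p, hp⟩ := hblock a
    obtain ⟨q, hq⟩ : ∃ q, μ.embedding (blockOf μ π a) q = π⁻¹ c := hac ▸ hblock c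
    rw [embedding_relValue μ π hp.symm, embedding_relValue μ π hq.symm]
    refine (μ.embedding _).strictMono ((std_lt_std_iff (block_injective μ π _) _ _).2 ?_)
    simpa only [block, hp, hq, Perm.inv_def, Equiv.apply_symm_apply] using hlt

theorem relLetter_eq (h : BlockForm μ π U y) (hi : blockOf μ π i.lo = blockOf μ π i.hi) :
    (relLetter μ π i hi).lo = U i.lo ∧ (relLetter μ π i hi).hi = U i.hi := by
  have hlo : (relLetter μ π i hi).lo = U i.lo := congrFun h.embedding_relValue_eq i.lo
  refine ⟨hlo, ?_⟩
  rw [h.blockOf_eq, h.blockOf_eq] at hi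
  exact Fin.ext ((congrArg (fun a : Fin n => a.1 + 1) hlo).trans
    (Nat.covBy_iff_add_one_eq.1 (Fin.covBy_iff.1 (h.covBy hi))))

theorem muAct_of_index_ne (h : BlockForm μ π U y) (hi : μ.index (U i.lo) ≠ μ.index (U i.hi)) :
    muAct μ π i = if π⁻¹ i.lo < π⁻¹ i.hi then simple i * π else π := by
  rw [muAct, dif_neg (by rwa [h.blockOf_eq, h.blockOf_eq]), heckeLeft_eq]

theorem muAct_of_index_eq (h : BlockForm μ π U y) (hi : μ.index (U i.lo) = μ.index (U i.hi)) :
    muAct μ π i = if y i.lo < y i.hi then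
      if y i.lo = i.lo ∧ y i.hi = i.hi then simple i * π
      else simple i * π * (U * simple i * U⁻¹) else π := by
  have hb : blockOf μ π i.lo = blockOf μ π i.hi := by rwa [h.blockOf_eq, h.blockOf_eq]
  obtain ⟨hlo, hhi⟩ := h.relLetter_eq hb
  have hsimple : simple (relLetter μ π i hb) = U * simple i * U⁻¹ := by
    rw [simple, hlo, hhi, Equiv.swap_apply_apply]; rfl
  rw [muAct, dif_pos hb, heckeRight_eq, heckeLeft_eq, hlo, hhi, hsimple]
  have hleft : π⁻¹ i.lo < π⁻¹ i.hi ↔ y i.lo < y i.hi := by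
    rw [h.inv_apply, h.inv_apply, h.lt_iff_lt (by rw [h.block_eq, h.block_eq, hi])]
  by_cases hy : y i.lo < y i.hi
  · have hnot : ¬(y i.lo = i.hi ∧ y i.hi = i.lo) := fun e =>
      i.lo_lt_hi.not_gt (by rwa [e.1, e.2] at hy)
    simp only [hleft, hy, if_true, Perm.mul_apply, h.apply_apply, simple_lt_simple_iff, true_and,
      hnot, or_false, ite_not]
  · simp only [hleft, hy, if_false, h.apply_apply]

theorem conj_simple_of_index_ne (h : BlockForm μ π U y)
    (hi : μ.index (U i.lo) ≠ μ.index (U i.hi)) :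
    BlockForm μ (simple i * π) (U * simple i) (simple i ∘ y ∘ simple i) where
  inv_apply a := by
    simp only [mul_inv_rev, simple_inv, Perm.mul_apply, Function.comp_apply, simple_simple,
      h.inv_apply]
  invol a := by simp only [Function.comp_apply, simple_simple, h.invol _]
  block_eq a := by simp only [Function.comp_apply, Perm.mul_apply, simple_simple, h.block_eq]
  mono a c hac hlt := by
    refine h.mono _ _ hac (simple_lt_simple_iff.2 (.inl ⟨hlt, ?_⟩))
    rintro ⟨rfl, rfl⟩
    simp only [Perm.mul_apply, simple_apply_lo, simple_apply_hi] at hac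
    exact hi hac.symm

theorem conj_simple_of_index_eq (h : BlockForm μ π U y)
    (hi : μ.index (U i.lo) = μ.index (U i.hi)) :
    BlockForm μ (simple i * π * (U * simple i * U⁻¹)) U (simple i ∘ y ∘ simple i) where
  inv_apply a := by
    simp only [mul_inv_rev, inv_inv, simple_inv, Perm.mul_apply, Function.comp_apply, h.inv_apply]
    simp only [Perm.inv_def, Equiv.symm_apply_apply]
  invol a := by simp only [Function.comp_apply, simple_simple, h.invol _]
  block_eq a := by
    have hs := comp_simple_eq (f := fun a => μ.index (U a)) hi
    simp only [Function.comp_apply, hs, h.block_eq]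
  mono := h.mono

theorem simple_comp (h : BlockForm μ π U y) (hi : μ.index (U i.lo) = μ.index (U i.hi))
    (hlo : y i.lo = i.lo) (hhi : y i.hi = i.hi) :
    BlockForm μ (simple i * π) U (simple i ∘ y) := by
  have hcomm := comp_simple_of_fixed h.invol hlo hhi
  exact
  { inv_apply := fun a => by
      simp only [mul_inv_rev, simple_inv, Perm.mul_apply, Function.comp_apply, h.inv_apply, hcomm]
    invol := fun a => by
      simp only [Function.comp_apply, hcomm, simple_simple, h.invol a]
    block_eq := fun a => by
      have hs := comp_simple_eq (f := fun a => μ.index (U a)) hi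
      simp only [Function.comp_apply, hs, h.block_eq]
    mono := h.mono }

end BlockForm

/-- The data attached to a `μ`-atom `w` of `π`: the factorization `π⁻¹ = U ∘ y`, in which every
letter lies in the same block as it does in `w`, and the pattern conditions relating `w` to `y`. -/
structure AtomForm {n : ℕ} (μ : Composition n) (w π U : Perm (Fin n)) (y : Fin n → Fin n) :
    Prop where
  blockForm : BlockForm μ π U y
  index_eq : ∀ a, μ.index (U a) = μ.index (w a)
  atomLike : AtomLike μ.index w y

section Words

variable {n : ℕ} {μ : Composition n} {w π U : Perm (Fin n)} {y : Fin n → Fin n} {i : Letter n}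

theorem AtomForm.exists_muAct (h : AtomForm μ w π U y) (hw : w i.lo < w i.hi)
    (hne : muAct μ π i ≠ π) : ∃ U' y', AtomForm μ (w * simple i) (muAct μ π i) U' y' := by
  obtain ⟨hB, hidx, hA⟩ := h
  by_cases hi : μ.index (U i.lo) = μ.index (U i.hi)
  · have hs : ∀ a, μ.index (U a) = μ.index (w (simple i a)) := fun a => by
      rw [← hidx, comp_simple_eq (f := fun a => μ.index (U a)) hi]
    rw [hB.muAct_of_index_eq hi] at hne ⊢
    have hy : y i.lo < y i.hi := by_contra fun hy => hne (if_neg hy)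
    rw [if_pos hy]
    split_ifs with hfix
    · exact ⟨_, _, hB.simple_comp hi hfix.1 hfix.2, hs,
        hA.simple_comp (by rw [← hidx, ← hidx, hi]) hw hfix.1 hfix.2⟩
    · exact ⟨_, _, hB.conj_simple_of_index_eq hi, hs,
        hA.conj_simple (fun _ => ⟨hy, hfix⟩) (index_monotone μ)⟩
  · rw [hB.muAct_of_index_ne hi] at hne ⊢
    rw [if_pos (by_contra fun hlt => hne (if_neg hlt))]
    exact ⟨_, _, hB.conj_simple_of_index_ne hi, fun a => hidx _,
      hA.conj_simple (fun e => absurd ((hidx _).trans (e.trans (hidx _).symm)) hi)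
        (index_monotone μ)⟩

theorem muLen_le (μ : Composition n) (a : List (Letter n)) :
    muLen μ (a.foldl (muAct μ) 1) ≤ a.length :=
  Nat.sInf_le ⟨a, rfl, rfl⟩

theorem muLen_muAct_le (μ : Composition n) (a : List (Letter n)) (i : Letter n) :
    muLen μ (muAct μ (a.foldl (muAct μ) 1) i) ≤ muLen μ (a.foldl (muAct μ) 1) + 1 := by
  obtain ⟨b, hb, hlen⟩ := Nat.sInf_mem
    (s := {p | ∃ b, IsMuWord μ b (a.foldl (muAct μ) 1) ∧ b.length = p}) ⟨_, a, rfl, rfl⟩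
  have := muLen_le μ (b ++ [i])
  rw [List.foldl_append, hb, List.length_append] at this
  exact this.trans (Nat.add_le_add_right hlen.le 1)

theorem exists_atomForm_of_word (μ : Composition n) (a : List (Letter n))
    (hlen : a.length = len (wordProd a)) (hmuLen : a.length = muLen μ (a.foldl (muAct μ) 1)) :
    ∃ U y, AtomForm μ (wordProd a) (a.foldl (muAct μ) 1) U y := by
  induction a using List.reverseRecOn with
  | nil => exact ⟨1, id, .one μ, fun _ => rfl, .refl _ strictMono_id⟩
  | append_singleton a i ih =>
    rw [wordProd_append_singleton, List.length_append, List.length_singleton] at hlen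
    rw [List.foldl_append, List.length_append, List.length_singleton] at hmuLen
    simp only [List.foldl_cons, List.foldl_nil, wordProd_append_singleton, List.foldl_append]
      at hmuLen ⊢
    have hlen_le := len_wordProd_le a
    have hmuLen_le := muLen_le μ a
    have hmuLen_act := muLen_muAct_le μ a i
    have hlt : wordProd a i.lo < wordProd a i.hi := by
      by_contra! hge
      have hgt := card_inversions_mul_simple_of_gt
        (hge.lt_of_ne ((wordProd a).injective.ne i.lo_lt_hi.ne'))
      have hle := card_inversions_wordProd_le a
      rw [len_eq_card_inversions] at hlen
      omega
    have hne : muAct μ (a.foldl (muAct μ) 1) i ≠ a.foldl (muAct μ) 1 := fun e => by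
      rw [e] at hmuLen
      omega
    obtain ⟨U, y, h⟩ := ih (by
      rw [len_eq_card_inversions, card_inversions_mul_simple hlt, ← len_eq_card_inversions] at hlen
      omega) (by omega)
    exact h.exists_muAct hlt hne

theorem exists_atomForm (h : w ∈ muAtoms μ π) : ∃ U y, AtomForm μ w π U y := by
  obtain ⟨a, ⟨rfl, hlen⟩, rfl, hmuLen⟩ := h
  exact exists_atomForm_of_word μ a hlen hmuLen

end Words

/-- The letters of the cycles of `i` and `j` under the involution `y`. -/
def cycleLetters {α : Type*} [DecidableEq α] (i j : α) (y : α → α) : Finset α := {i, j, y i, y j}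

section CycleLetters

variable {α : Type*} [DecidableEq α] {i j a : α} {y : α → α}

theorem mem_cycleLetters : a ∈ cycleLetters i j y ↔ a = i ∨ a = j ∨ a = y i ∨ a = y j := by
  simp only [cycleLetters, Finset.mem_insert, Finset.mem_singleton]

theorem card_cycleLetters_le : (cycleLetters i j y).card ≤ 4 := Finset.card_le_four

theorem apply_mem_cycleLetters (hy : Function.Involutive y) (ha : a ∈ cycleLetters i j y) :
    y a ∈ cycleLetters i j y := by
  rw [mem_cycleLetters] at ha ⊢
  rcases ha with rfl | rfl | rfl | rfl <;> simp only [hy _, true_or, or_true]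

end CycleLetters

section CycleLetters

variable {α β ι : Type*} [LinearOrder α] [LinearOrder β] [Finite α] [PartialOrder ι] {g : β → ι}
  {i j a : α} {w : α → β} {y z : α → α}

theorem AtomSwap.apply_eq_of_notMem (hg : Monotone g) (h : AtomSwap g i j w y z)
    (ha : a ∉ cycleLetters i j y) : z a = y a := by
  simp only [mem_cycleLetters, not_or] at ha
  obtain ⟨hi, hj, hyi, hyj⟩ := ha
  exact h.apply_eq hg hi hj (fun e => hyi (by rw [← e, h.source.invol]))
    (fun e => hyj (by rw [← e, h.source.invol]))

theorem AtomSwap.target_mem_cycleLetters (hg : Monotone g) (h : AtomSwap g i j w y z)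
    (ha : a ∈ cycleLetters i j y) : z a ∈ cycleLetters i j y := by
  by_contra hz
  have hya := h.apply_eq_of_notMem hg hz
  rw [h.target.invol] at hya
  have := apply_mem_cycleLetters h.source.invol ha
  rw [hya, h.source.invol] at this
  exact hz this

end CycleLetters

section DifferentBlocks

variable {α β ι : Type*} [LinearOrder α] [LinearOrder β] {g : β → ι} {i j a b : α}
  {w w₁ w₂ : α → β} {y z z₁ z₂ : α → α}

theorem AtomLike.apply_lt_apply_iff (h : AtomLike g w y) (ha : y a ≠ a) :
    w (y a) < w a ↔ a < y a := by
  rcases lt_or_gt_of_ne ha with hlt | hlt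
  · exact iff_of_false (h.desc' hlt).not_gt hlt.not_gt
  · exact iff_of_true (h.desc a hlt) hlt

theorem AtomLike.apply_eq_iff_of_pair (h : AtomLike g w y) (hab : a ≠ b)
    (hg : g (w a) = g (w b)) (ha : y a = a ∨ y a = b) (hb : y b = a ∨ y b = b) :
    y a = b ↔ (w b < w a ↔ a < b) := by
  constructor
  · rintro rfl
    exact h.apply_lt_apply_iff hab.symm
  · contrapose
    intro hne hiff
    replace ha := ha.resolve_right hne
    replace hb := hb.resolve_left fun e => hab (by rw [← h.invol b, e, ha])
    rcases lt_or_gt_of_ne hab with hlt | hlt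
    · have := h.order a b hg ha.ge hb.ge hlt (by rwa [ha, hb])
      rw [hb] at this
      exact this.not_gt (hiff.2 hlt)
    · have := h.order b a hg.symm hb.ge ha.ge hlt (by rwa [ha, hb])
      rw [ha] at this
      exact hlt.not_gt (hiff.1 this)

theorem AtomSwap.eq_or_eq_of_mem_cycleLetters (h : AtomSwap g i j w y z)
    (hne : g (w i) ≠ g (w j)) (ha : a ∈ cycleLetters i j y)
    (hga : g ((w ∘ swap i j) a) = g (w j)) : a = i ∨ a = y j ∧ y j ≠ j := by
  have hyi := h.source.block_eq i
  rw [mem_cycleLetters] at ha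
  simp only [Function.comp_apply, swap_apply_def] at hga
  grind

variable [Finite α] [PartialOrder ι]

theorem AtomSwap.target_eq_or_eq (hg : Monotone g) (h : AtomSwap g i j w y z)
    (hne : g (w i) ≠ g (w j)) (ha : a = i ∨ a = y j ∧ y j ≠ j) :
    z a = i ∨ z a = y j ∧ y j ≠ j := by
  have hyj := h.source.block_eq j
  refine h.eq_or_eq_of_mem_cycleLetters hne (h.target_mem_cycleLetters hg ?_) ?_
  · rw [mem_cycleLetters]
    tauto
  · rw [h.target.block_eq]
    simp only [Function.comp_apply, swap_apply_def]
    grind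

theorem AtomSwap.target_eq_source_right_iff (hg : Monotone g) (h : AtomSwap g i j w y z)
    (hne : g (w i) ≠ g (w j)) (hj : y j ≠ j) : z i = y j ↔ (j < y j ↔ i < y j) := by
  have hyji : y j ≠ i := fun e => hne (by rw [← e, h.source.block_eq])
  have hwi : (w ∘ swap i j) i = w j := congrArg w (swap_apply_left i j)
  have hwj : (w ∘ swap i j) (y j) = w (y j) := comp_swap_apply_of_ne w hyji hj
  rw [h.target.apply_eq_iff_of_pair hyji.symm (by rw [hwi, hwj, h.source.block_eq])
    ((h.target_eq_or_eq hg hne (.inl rfl)).imp_right And.left)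
    ((h.target_eq_or_eq hg hne (.inr ⟨rfl, hj⟩)).imp_right And.left), hwi, hwj,
    h.source.apply_lt_apply_iff hj]

theorem AtomSwap.target_eq_of_block_ne (hg : Monotone g) (h₁ : AtomSwap g i j w₁ y z₁)
    (h₂ : AtomSwap g i j w₂ y z₂) (hne₁ : g (w₁ i) ≠ g (w₁ j)) (hne₂ : g (w₂ i) ≠ g (w₂ j))
    (ha : a = i ∨ a = y j ∧ y j ≠ j) : z₁ a = z₂ a := by
  have hleft : z₁ i = z₂ i := by
    have hz₁ := h₁.target_eq_or_eq hg hne₁ (.inl rfl)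
    have hz₂ := h₂.target_eq_or_eq hg hne₂ (.inl rfl)
    by_cases hj : y j = j
    · simp only [hj, ne_eq, not_true, and_false, or_false] at hz₁ hz₂
      rw [hz₁, hz₂]
    · have hiff := (h₁.target_eq_source_right_iff hg hne₁ hj).trans
        (h₂.target_eq_source_right_iff hg hne₂ hj).symm
      grind
  rcases ha with rfl | ⟨rfl, hj⟩
  · exact hleft
  · have hz₁ := h₁.target_eq_or_eq hg hne₁ (.inr ⟨rfl, hj⟩)
    have hz₂ := h₂.target_eq_or_eq hg hne₂ (.inr ⟨rfl, hj⟩)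
    have hiff : z₁ (y j) = i ↔ z₂ (y j) = i := by
      rw [h₁.target.invol.eq_iff, h₂.target.invol.eq_iff, hleft]
    grind

end DifferentBlocks

section SameBlock

theorem atomLike_const_iff {α : Type*} [LinearOrder α] {w : Perm α} {y : α → α} :
    AtomLike (fun _ => ()) w y ↔
      (∀ a, y (y a) = a) ∧ (∀ a, a < y a → w (y a) < w a) ∧
      (∀ a t, a < t → t < y a → ¬(w (y a) < w t ∧ w t < w a)) ∧
      (∀ a c, a ≤ y a → c ≤ y c → a < c → y a < y c → w a < w (y c)) :=
  ⟨fun h => ⟨h.invol, h.desc, h.not_between, fun a c => h.order a c rfl⟩,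
    fun h => ⟨w.injective, h.1, fun _ => rfl, h.2.1, h.2.2.1, fun a c _ => h.2.2.2 a c⟩⟩

instance {α : Type*} [LinearOrder α] [Fintype α] (w : Perm α) (y : α → α) :
    Decidable (AtomLike (fun _ => ()) w y) :=
  decidable_of_iff _ atomLike_const_iff.symm

instance {α β : Type*} [Fintype α] [LinearOrder α] [LinearOrder β] (w : α → β) (i j : α) :
    Decidable (CoverSwap w i j) :=
  decidable_of_iff (i < j ∧ w i < w j ∧ ∀ k, i < k → k < j → ¬(w i < w k ∧ w k < w j))
    ⟨fun h => ⟨h.1, h.2.1, h.2.2⟩, fun h => ⟨h.lt, h.apply_lt, h.not_between⟩⟩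

/-- The involution that replaces `y` when all letters lie on the cycles of `i < j` and in a single
block, and a cover `w ⋖ w t_{ij}` leads from an atom of `y` to an atom: the conjugate of `y` by
`t_{ij}`, unless `i` and `j` are both fixed or one of their partners lies between them. -/
def swapTarget {α : Type*} [LinearOrder α] (i j : α) (y : Perm α) : Perm α :=
  if (y i ≤ i ∨ j ≤ y i) ∧ (y j ≤ i ∨ j ≤ y j) ∧ ¬(y i = i ∧ y j = j) then
    swap i j * y * swap i j
  else swap (min i (y i)) (max j (y j)) * if y j < y i then swap (y i) (y j) else 1

theorem eq_swapTarget_of_le_four : ∀ m ≤ 4, ∀ w y : Perm (Fin m), AtomLike (fun _ => ()) w y →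
    ∀ i j, CoverSwap w i j → (∀ a, a = i ∨ a = j ∨ a = y i ∨ a = y j) →
      ∀ z : Perm (Fin m), AtomLike (fun _ => ()) (w * swap i j : Perm (Fin m)) z →
        z = swapTarget i j y := by
  intro m hm
  interval_cases m <;> decide +kernel

theorem exists_perm_of_forall_mem_range {α κ : Type*} {e : κ → α} (he : Function.Injective e)
    {f : α → α} (hf : Function.Involutive f) (hrange : ∀ a, f (e a) ∈ Set.range e) :
    ∃ f' : Perm κ, ∀ a, e (f' a) = f (e a) := by
  choose f' hf' using hrange
  have hinvol : Function.Involutive f' := fun a => he (by rw [hf', hf', hf])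
  exact ⟨hinvol.toPerm f', hf'⟩

theorem AtomLike.restrict {α α' β β' ι : Type*} [LinearOrder α] [LinearOrder α'] [LinearOrder β]
    [LinearOrder β'] {g : β → ι} {w : α → β} {y : α → α} (h : AtomLike g w y) (e : α' ↪o α)
    {w' : α' → β'} {y' : α' → α'} (hw : ∀ a c, w' a < w' c ↔ w (e a) < w (e c))
    (hy : ∀ a, e (y' a) = y (e a)) (hg : ∀ a c, g (w (e a)) = g (w (e c))) :
    AtomLike (fun _ => ()) w' y' where
  inj a c hac := e.injective <| h.inj <| le_antisymm
    (le_of_not_gt fun hlt => ((hw c a).2 hlt).ne' hac)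
    (le_of_not_gt fun hlt => ((hw a c).2 hlt).ne hac)
  invol a := e.injective (by rw [hy, hy, h.invol])
  block_eq _ := rfl
  desc a := by
    rw [hw, hy, ← e.lt_iff_lt, hy]
    exact h.desc (e a)
  not_between a t := by
    rw [hw, hw, hy, ← e.lt_iff_lt, ← e.lt_iff_lt, hy]
    exact h.not_between (e a) (e t)
  order a c _ := by
    rw [hw, hy, ← e.le_iff_le, ← e.le_iff_le, ← e.lt_iff_lt, ← e.lt_iff_lt, hy, hy]
    exact h.order (e a) (e c) (hg a c)

theorem AtomSwap.block_eq_of_mem_cycleLetters {α β ι : Type*} [LinearOrder α] [LinearOrder β]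
    {g : β → ι} {i j a : α} {w : α → β} {y z : α → α} (h : AtomSwap g i j w y z)
    (hij : g (w i) = g (w j)) (ha : a ∈ cycleLetters i j y) : g (w a) = g (w i) := by
  rw [mem_cycleLetters] at ha
  rcases ha with rfl | rfl | rfl | rfl <;> simp only [h.source.block_eq, hij]

variable {α ι : Type*} [LinearOrder α] [Finite α] [PartialOrder ι] {n m : ℕ} {g : Fin n → ι}
  {w w₁ w₂ : α → Fin n} {y z z₁ z₂ : α → α}

theorem AtomSwap.target_eq_swapTarget (hg : Monotone g) (hm : m ≤ 4) {e : Fin m ↪o α}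
    {i j : Fin m} (h : AtomSwap g (e i) (e j) w y z)
    (hrange : ∀ {x}, x ∈ Set.range e ↔ x ∈ cycleLetters (e i) (e j) y) {y' : Perm (Fin m)}
    (hy : ∀ a, e (y' a) = y (e a)) (hij : g (w (e i)) = g (w (e j))) (a : Fin m) :
    z (e a) = e (swapTarget i j y' a) := by
  have hmem : ∀ x, e x ∈ cycleLetters (e i) (e j) y := fun x => hrange.1 ⟨x, rfl⟩
  obtain ⟨z', hz⟩ := exists_perm_of_forall_mem_range e.injective h.target.invol fun x =>
    hrange.2 (h.target_mem_cycleLetters hg (hmem x))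
  have hblock : ∀ x, g (w (e x)) = g (w (e i)) := fun x =>
    h.block_eq_of_mem_cycleLetters hij (hmem x)
  have hmem' : ∀ x, x = i ∨ x = j ∨ x = y' i ∨ x = y' j := fun x => by
    simpa only [mem_cycleLetters, ← e.injective.eq_iff, hy] using hmem x
  have hstd := std_lt_std_iff (h.source.inj.comp e.injective)
  have hswap : ∀ x, (w ∘ swap (e i) (e j)) (e x) = w (e (swap i j x)) := fun x =>
    congrArg w (e.injective.map_swap i j x).symm
  have hcover : CoverSwap (std (w ∘ e)) i j :=
    { lt := e.lt_iff_lt.1 h.cover.lt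
      apply_lt := (hstd i j).2 h.cover.apply_lt
      not_between := fun k hik hkj => by
        rw [hstd, hstd]
        exact h.cover.not_between (e k) (e.lt_iff_lt.2 hik) (e.lt_iff_lt.2 hkj) }
  have hsource : AtomLike (fun _ => ()) (std (w ∘ e)) y' :=
    h.source.restrict e hstd hy fun a c => (hblock a).trans (hblock c).symm
  have htarget : AtomLike (fun _ => ()) (std (w ∘ e) * swap i j : Perm (Fin m)) z' :=
    h.target.restrict e (fun a c => by rw [hswap, hswap]; exact hstd _ _) hz
      fun a c => by
        rw [hswap, hswap]
        exact (hblock _).trans (hblock _).symm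
  rw [← hz, eq_swapTarget_of_le_four m hm _ y' hsource i j hcover hmem' z' htarget]

theorem AtomSwap.target_eq_of_block_eq {i j a : α} (hg : Monotone g)
    (h₁ : AtomSwap g i j w₁ y z₁) (h₂ : AtomSwap g i j w₂ y z₂) (hij₁ : g (w₁ i) = g (w₁ j))
    (hij₂ : g (w₂ i) = g (w₂ j)) (ha : a ∈ cycleLetters i j y) : z₁ a = z₂ a := by
  obtain ⟨m, hm, e, hrange⟩ : ∃ m ≤ 4, ∃ e : Fin m ↪o α,
      ∀ {x}, x ∈ Set.range e ↔ x ∈ cycleLetters i j y :=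
    ⟨_, card_cycleLetters_le, (cycleLetters i j y).orderEmbOfFin rfl, fun {x} => by
      rw [Finset.range_orderEmbOfFin, Finset.mem_coe]⟩
  obtain ⟨i, rfl⟩ := hrange.2 (mem_cycleLetters.2 (.inl rfl))
  obtain ⟨j, rfl⟩ := hrange.2 (mem_cycleLetters.2 (.inr (.inl rfl)))
  obtain ⟨a, rfl⟩ := hrange.2 ha
  obtain ⟨y', hy⟩ := exists_perm_of_forall_mem_range e.injective h₁.source.invol fun x =>
    hrange.2 (apply_mem_cycleLetters h₁.source.invol (hrange.1 ⟨x, rfl⟩))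
  rw [h₁.target_eq_swapTarget hg hm hrange hy hij₁, h₂.target_eq_swapTarget hg hm hrange hy hij₂]

end SameBlock

theorem AtomSwap.unique {α ι : Type*} [LinearOrder α] [Finite α] [PartialOrder ι] {n : ℕ}
    {g : Fin n → ι} {i j : α} {w₁ w₂ : α → Fin n} {y z₁ z₂ : α → α} (hg : Monotone g)
    (h₁ : AtomSwap g i j w₁ y z₁) (h₂ : AtomSwap g i j w₂ y z₂)
    (hblock : ∀ a, g (w₁ a) = g (w₂ a)) : z₁ = z₂ := by
  funext a
  by_cases ha : a ∈ cycleLetters i j y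
  · by_cases hij : g (w₁ i) = g (w₁ j)
    · exact h₁.target_eq_of_block_eq hg h₂ hij (by rwa [← hblock, ← hblock]) ha
    · have hij₂ : g (w₂ i) ≠ g (w₂ j) := by rwa [← hblock, ← hblock]
      by_cases hright : a = i ∨ a = y j ∧ y j ≠ j
      · exact h₁.target_eq_of_block_ne hg h₂ hij hij₂ hright
      · refine AtomSwap.target_eq_of_block_ne (α := αᵒᵈ) (β := (Fin n)ᵒᵈ) hg.dual h₁.dual h₂.dual
          (Ne.symm hij) hij₂.symm ?_
        rw [mem_cycleLetters] at ha
        grind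
  · rw [h₁.apply_eq_of_notMem hg ha, h₂.apply_eq_of_notMem hg ha]

section Target

variable {n : ℕ} {μ : Composition n} {i j : Fin n} {π σ τ u v : Perm (Fin n)}

theorem target_unique_of_lt (hij : i < j) (hu : u ∈ muAtoms μ π) (hv : v ∈ muAtoms μ π)
    (hcu : BruhatCover u (u * swap i j)) (hcv : BruhatCover v (v * swap i j))
    (hσ : u * swap i j ∈ muAtoms μ σ) (hτ : v * swap i j ∈ muAtoms μ τ) : σ = τ := by
  obtain ⟨U, y, hU⟩ := exists_atomForm hu
  obtain ⟨V, y', hV⟩ := exists_atomForm hv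
  obtain ⟨U', z, hU'⟩ := exists_atomForm hσ
  obtain ⟨V', z', hV'⟩ := exists_atomForm hτ
  obtain rfl := hU.blockForm.right_unique hV.blockForm
  have hblock : ∀ a, μ.index (u a) = μ.index (v a) := fun a => by
    rw [← hU.index_eq, ← hV.index_eq, ← hU.blockForm.blockOf_eq, ← hV.blockForm.blockOf_eq]
  obtain rfl : z = z' :=
    AtomSwap.unique (index_monotone μ) ⟨hcu.coverSwap hij, hU.atomLike, hU'.atomLike⟩
      ⟨hcv.coverSwap hij, hV.atomLike, hV'.atomLike⟩ hblock
  refine hU'.blockForm.perm_unique hV'.blockForm fun a => ?_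
  rw [hU'.index_eq, hV'.index_eq, Perm.mul_apply, Perm.mul_apply, hblock]

theorem target_unique (hu : u ∈ muAtoms μ π) (hv : v ∈ muAtoms μ π)
    (hcu : BruhatCover u (u * swap i j)) (hcv : BruhatCover v (v * swap i j))
    (hσ : u * swap i j ∈ muAtoms μ σ) (hτ : v * swap i j ∈ muAtoms μ τ) : σ = τ := by
  rcases lt_trichotomy i j with hij | rfl | hij
  · exact target_unique_of_lt hij hu hv hcu hcv hσ hτ
  · have := hcu.2
    rw [swap_self, ← Perm.one_def, mul_one] at this
    omega
  · rw [swap_comm] at hcu hcv hσ hτ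
    exact target_unique_of_lt hij hu hv hcu hcv hσ hτ

end Target

theorem isTransposeValue_existsUnique {n : ℕ} (μ : Composition n) (i j : Fin n)
    (π : muInvolutions μ) : ∃! τ : muInvolutions μ, IsTransposeValue μ i j π τ := by
  by_cases h : ∃ σ : muInvolutions μ, AtomCover μ i j π.1 σ.1
  · obtain ⟨σ, hσ⟩ := h
    refine ⟨σ, Or.inl hσ, fun τ hτ => ?_⟩
    rcases hτ with hτ | ⟨hτ, -⟩
    · obtain ⟨u, hu, hcu, hu'⟩ := hσ
      obtain ⟨v, hv, hcv, hv'⟩ := hτ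
      exact Subtype.ext (target_unique hv hu hcv hcu hv' hu')
    · exact absurd ⟨σ, hσ⟩ hτ
  · refine ⟨π, Or.inr ⟨h, rfl⟩, fun τ hτ => ?_⟩
    rcases hτ with hτ | ⟨-, hτ⟩
    · exact absurd ⟨τ, hτ⟩ h
    · exact hτ

end MuInv

theorem lemma3p8 {n : ℕ} (μ : Composition n) (i j : Fin n) :
    (∃! T : MuInv.muInvolutions μ → MuInv.muInvolutions μ,
      ∀ π τ : MuInv.muInvolutions μ, MuInv.IsTransposeValue μ i j π τ ↔ T π = τ) ∧
    (∀ π σ τ : MuInv.muInvolutions μ, ∀ u ∈ MuInv.muAtoms μ π.1, ∀ v ∈ MuInv.muAtoms μ π.1,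
      MuInv.BruhatCover u (u * Equiv.swap i j) → MuInv.BruhatCover v (v * Equiv.swap i j) →
      u * Equiv.swap i j ∈ MuInv.muAtoms μ σ.1 → v * Equiv.swap i j ∈ MuInv.muAtoms μ τ.1 →
      σ = τ) := by
  refine ⟨?_, fun π σ τ u hu v hv hcu hcv hσ hτ =>
    Subtype.ext (MuInv.target_unique hu hv hcu hcv hσ hτ)⟩
  choose T hT hT' using MuInv.isTransposeValue_existsUnique μ i j
  refine ⟨T, fun π τ => ⟨fun h => (hT' π τ h).symm, fun h => h ▸ hT π⟩, fun T' h => ?_⟩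
  exact funext fun π => hT' π _ ((h π _).2 rfl)
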